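/- **Theorem.** A *Motzkin tree* is a rooted plane unary-binary tree: each node is a leaf, a unary node, or a binary node with a left and a right child. Its size $|T|$ is its total number of nodes, and $M_n$ is the number of Motzkin trees of size $n$. A *colour-pointed tree* is a Motzkin tree with a blue pointed leaf, a red pointed leaf, or a green pointed unary node. *Repointing* a colour-pointed tree $T$ gives a node $v$ of $T$, or $v=\bot$, as follows; the root counts as a right child, and a node counts among its own ancestors. If $T$ has a blue leaf, then $v$ is the first ancestor of that leaf (going up) that is a left child, and $v=\bot$ if there is none. If $T$ has a red leaf, then $v$ is the first ancestor of that leaf that is a right child. If $T$ has a green unary node, then $v$ is its child. *Grafts.* $G1$ acts on a colour-pointed tree: a blue or red leaf gets a new unary node as its father and keeps its colour; a green unary node becomes binary, its child becomes its left child, and its right child is a new red pointed leaf. $G2,\dots,G5$ act on a tree with a pointed node $v$: $G2$ inserts a new green pointed unary node as the father of $v$; $G3$, $G4$, $G5$ insert a new binary node as the father of $v$, whose other child is a new pointed leaf, namely a blue right child for $G3$, a red left child for $G4$, and a blue left child for $G5$. *Try($n$).* Start with a tree reduced to one leaf, coloured blue or red with probability $1/2$ each. While $|T|<n$, choose one of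 $G1,\dots,G5$ with probabilities $\frac13,\frac13,\frac19,\frac19,\frac19$; if it is $G1$, replace $T$ by $G1(T)$; otherwise repoint $T$, return FAIL if $v=\bot$, and else apply the chosen graft to $(T,v)$. Finally return $T$. All random choices are independent. *Sampler($n$).* Run Try($n$) repeatedly, with fresh randomness, until it returns neither FAIL nor a tree of size $n+1$; output the tree that was returned, forgetting its point. *Running time* is the total number of elementary steps over all tries, failed ones included. In one step the sampler makes at most one random choice (a fair coin flip or a uniform integer with $9$ values) and a bounded number of elementary operations at the current node (find out what kind of node and what kind of child it is, move to its father or to a child, insert or modify nodes there, update or compare the size counter). In particular, during repointing each move from a node to its father costs one step. Then, for every $n\ge 1$, Sampler($n$) stops with probability $1$ and outputs a Motzkin tree of size $n$, and each Motzkin tree of size $n$ is output with probability $1/M_n$. Moreover the expected running time is linear: there is a constant $C$ such that, for every $n\ge1$, the expected running time of Sampler($n$) is at most $C\,n$. -/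

import Mathlib

open scoped NNReal ENNReal

namespace MotzkinSampler

/-- Motzkin trees, that is, rooted plane unary-binary trees. -/
inductive MTree : Type
  | leaf : MTree
  | unary (t : MTree) : MTree
  | binary (l r : MTree) : MTree

namespace MTree

/-- The size of a tree: its number of nodes (leaves, unary nodes and binary nodes). -/
def numNodes : MTree → ℕ
  | leaf => 1
  | unary t => t.numNodes + 1
  | binary l r => l.numNodes + r.numNodes + 1

end MTree

/-- How a non-root node hangs below its father: it is an only child, a left child (with the
subtree at its right sibling), or a right child (with the subtree at its left sibling). -/
inductive Frame : Type
  | only : Frame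
  | left (rightSibling : MTree) : Frame
  | right (leftSibling : MTree) : Frame

/-- The surroundings of a node in a tree: the frames met on the way from the node up to the root,
starting at the node. The root has the empty context. -/
abbrev Context : Type := List Frame

/-- The subtree at the father of a node, from the frame of the node and the subtree `t` at it. -/
def Frame.father : Frame → MTree → MTree
  | only, t => MTree.unary t
  | left r, t => MTree.binary t r
  | right l, t => MTree.binary l t

/-- The whole tree, from the context of a node and the subtree at this node. -/
def Context.plug : Context → MTree → MTree
  | [], t => t
  | f :: c, t => Context.plug c (f.father t)

/-- A tree with a pointed node `v`, held as the context of `v` and the subtree at `v`. In this form,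
finding out what kind of child and what kind of node `v` is, moving the point to the father or to a
child of `v`, and inserting nodes next to `v`, all take a bounded number of elementary operations. -/
structure PointedTree : Type where
  context : Context
  subtree : MTree

/-- Colour-pointed trees: a tree with a blue pointed leaf, a red pointed leaf, or a green pointed
unary node. The point is given by its context and, if it is green, by the subtree at its child. -/
inductive ColorPointedTree : Type
  | blue (c : Context) : ColorPointedTree
  | red (c : Context) : ColorPointedTree
  | green (c : Context) (child : MTree) : ColorPointedTree

/-- The underlying tree of a colour-pointed tree. -/
def ColorPointedTree.tree : ColorPointedTree → MTree
  | blue c => Context.plug c MTree.leaf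
  | red c => Context.plug c MTree.leaf
  | green c t => Context.plug c (MTree.unary t)

/-- The graft G1. A blue or red pointed leaf gets a new unary father and keeps its colour; a green
pointed unary node becomes binary, its child becomes its left child, and its right child is a new,
red pointed leaf. -/
def graft1 : ColorPointedTree → ColorPointedTree
  | .blue c => .blue (Frame.only :: c)
  | .red c => .red (Frame.only :: c)
  | .green c t => .red (Frame.right t :: c)

/-- The names of the grafts that act on a tree with a pointed node. -/
inductive Graft : Type
  | G2 | G3 | G4 | G5

/-- G2 inserts a green pointed unary node above the pointed node. The others insert a binary node
above the pointed node; its other child is a new pointed leaf: a blue right child for G3, a red left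
child for G4, a blue left child for G5. -/
def Graft.apply : Graft → PointedTree → ColorPointedTree
  | .G2, ⟨c, t⟩ => .green c t
  | .G3, ⟨c, t⟩ => .blue (Frame.right t :: c)
  | .G4, ⟨c, t⟩ => .red (Frame.left t :: c)
  | .G5, ⟨c, t⟩ => .blue (Frame.left t :: c)

/-- The number of nodes that a graft adds. -/
def Graft.added : Graft → ℕ
  | .G2 => 1
  | .G3 => 2
  | .G4 => 2
  | .G5 => 2

/-- The choice of a graft from a uniform integer with nine values: G1 (encoded as `none`) and G2
have probability 1/3 each, and G3, G4, G5 have probability 1/9 each. -/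
def chooseGraft : Fin 9 → Option Graft
  | 0 | 1 | 2 => none
  | 3 | 4 | 5 => some .G2
  | 6 => some .G3
  | 7 => some .G4
  | 8 => some .G5

/-- The random draws available in one step: a fair coin and a uniform integer with nine values. -/
abbrev Draw : Type := Bool × Fin 9

/-- The states of the sampler. The natural number `s` is the counter holding the size of the
current tree. -/
inductive State : Type
  /-- A try is about to start. -/
  | start : State
  /-- Head of the loop of a try, with current tree `T`. -/
  | loop (T : ColorPointedTree) (s : ℕ) : State
  /-- Repointing from a blue leaf: `v` moves up until it is a left child; then `g` is applied. -/
  | seekLeft (g : Graft) (v : PointedTree) (s : ℕ) : State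
  /-- Repointing from a red leaf: `v` moves up until it is a right child; then `g` is applied. -/
  | seekRight (g : Graft) (v : PointedTree) (s : ℕ) : State
  /-- A try has returned a tree (with its size), or FAIL (encoded as `none`). -/
  | returned (r : Option (ColorPointedTree × ℕ)) : State
  /-- The sampler has stopped and returns `T`. -/
  | done (T : ColorPointedTree) : State

/-- One step of the sampler for size `n`: at most one random draw and a bounded number of
elementary operations on the counter and near the point of the tree. The root counts as a right
child. -/
def step (n : ℕ) (d : Draw) : State → State
  | .start => .loop (if d.1 then .blue [] else .red []) 1
  | .loop T s =>
      if s < n then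
        match chooseGraft d.2, T with
        | none, T => .loop (graft1 T) (s + 1)
        | some g, .blue c => .seekLeft g ⟨c, MTree.leaf⟩ s
        | some g, .red c => .seekRight g ⟨c, MTree.leaf⟩ s
        | some g, .green c t => .loop (g.apply ⟨Frame.only :: c, t⟩) (s + g.added)
      else .returned (some (T, s))
  | .seekLeft _ ⟨[], _⟩ _ => .returned none
  | .seekLeft g ⟨Frame.left r :: c, t⟩ s => .loop (g.apply ⟨Frame.left r :: c, t⟩) (s + g.added)
  | .seekLeft g ⟨f :: c, t⟩ s => .seekLeft g ⟨c, f.father t⟩ s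
  | .seekRight g ⟨[], t⟩ s => .loop (g.apply ⟨[], t⟩) (s + g.added)
  | .seekRight g ⟨Frame.right l :: c, t⟩ s => .loop (g.apply ⟨Frame.right l :: c, t⟩) (s + g.added)
  | .seekRight g ⟨f :: c, t⟩ s => .seekRight g ⟨c, f.father t⟩ s
  | .returned none => .start
  | .returned (some (T, s)) => if s = n + 1 then .start else .done T
  | .done T => .done T

/-- An infinite supply of random draws, one for each step. -/
abbrev Tape : Type := ℕ → Draw

/-- The state of the sampler for size `n` after `t` steps, on the draws `ω`. -/
def stateAt (n : ℕ) (ω : Tape) : ℕ → State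
  | 0 => .start
  | t + 1 => step n (ω t) (stateAt n ω t)

/-- On the draws `ω`, the sampler for size `n` stops and outputs the tree `T` (the coloured point
of the final tree is forgotten). -/
def Outputs (n : ℕ) (ω : Tape) (T : MTree) : Prop :=
  ∃ t : ℕ, ∃ P : ColorPointedTree, stateAt n ω t = .done P ∧ P.tree = T

/-- The running time: the number of steps until the sampler stops (`⊤` if it never stops). -/
noncomputable def runningTime (n : ℕ) (ω : Tape) : ℕ∞ :=
  ⨅ (t : ℕ) (_ : ∃ P : ColorPointedTree, stateAt n ω t = .done P), (t : ℕ∞)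

/-- The law of the draws: they are independent, and each is uniform. -/
noncomputable def drawLaw : MeasureTheory.Measure Tape :=
  MeasureTheory.Measure.infinitePi fun _ : ℕ => (PMF.uniformOfFintype Draw).toMeasure

end MotzkinSampler

/-!
The expected number of visits that the sampler pays to a state solves a linear system. A
colour-pointed tree of size `s ≤ n` arises from exactly one graft, applied to exactly one state, so
by induction on `s` the loop visits it `weight s = (3 / 2) * 3⁻¹ ^ s` times per try, whatever the
tree is. A tree of size `n` has exactly `n + 1` coloured points, since it has one more leaf than it
has binary nodes; forgetting the point of a uniform colour-pointed tree therefore leaves a uniform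
tree.

Repointing runs the same argument at each pointed node that it meets, hence costs no more than a
constant times the number of visits to the loop. The probability `reach s` that a try reaches the
size `s` satisfies a three-term recurrence, because a colour-pointed tree is a single leaf or one of
the grafts of a smaller one; the recurrence shows that `reach s` decreases so slowly that the sum of
the `reach s` with `s ≤ n` is at most `3 * n * reach n`. Since `reach n` times the expected number
of tries is the probability that the sampler stops, the total is linear in `n`.
-/

namespace MotzkinSampler

open MeasureTheory ProbabilityTheory

/-! ### Occupation measures of random iterations -/

section RandomIteration

variable {D S : Type*} [MeasurableSpace D] [MeasurableSpace S] {x y : S} {f : D → S → S}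

/-- The path of the random iteration `σ ↦ f d σ` from `x`, driven by the successive draws `ω`. -/
def trajectory (f : D → S → S) (x : S) (ω : ℕ → D) : ℕ → S
  | 0 => x
  | t + 1 => f (ω t) (trajectory f x ω t)

theorem exists_trajectory_eq_restrict (hf : Measurable (Function.uncurry f)) (x : S) (t : ℕ) :
    ∃ F : (Finset.range t → D) → S, Measurable F ∧
      ∀ ω, trajectory f x ω t = F fun i ↦ ω i := by
  induction t with
  | zero => exact ⟨fun _ ↦ x, measurable_const, fun _ ↦ rfl⟩
  | succ t ih =>
    obtain ⟨F, hF, h⟩ := ih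
    have hlt (i : Finset.range t) : (i : ℕ) ∈ Finset.range (t + 1) := by grind
    refine ⟨fun ω ↦ f (ω ⟨t, Finset.self_mem_range_succ t⟩) (F fun i ↦ ω ⟨i, hlt i⟩), ?_,
      fun ω ↦ by rw [trajectory, h]⟩
    have hrestrict : Measurable fun (ω : Finset.range (t + 1) → D) (i : Finset.range t) ↦
        ω ⟨i, hlt i⟩ := by fun_prop
    exact hf.comp (Measurable.prodMk (by fun_prop) (hF.comp hrestrict))

theorem measurable_trajectory (hf : Measurable (Function.uncurry f)) (x : S) (t : ℕ) :
    Measurable fun ω ↦ trajectory f x ω t := by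
  obtain ⟨F, hF, h⟩ := exists_trajectory_eq_restrict hf x t
  simp only [h]
  fun_prop

variable {μ : Measure D}

/-- The occupation measure of a random iteration with independent draws of law `μ`: it gives a set
the expected number of times at which the path is in this set. -/
noncomputable def occupation (μ : Measure D) (f : D → S → S) (x : S) : Measure S :=
  Measure.sum fun t ↦ (Measure.infinitePi fun _ : ℕ ↦ μ).map fun ω ↦ trajectory f x ω t

theorem lintegral_occupation (hf : Measurable (Function.uncurry f)) {g : S → ℝ≥0∞}
    (hg : Measurable g) :
    ∫⁻ σ, g σ ∂occupation μ f x =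
      ∑' t, ∫⁻ ω, g (trajectory f x ω t) ∂Measure.infinitePi (fun _ : ℕ ↦ μ) := by
  rw [occupation, lintegral_sum_measure]
  exact tsum_congr fun t ↦ lintegral_map hg (measurable_trajectory hf x t)

theorem lintegral_tsum_trajectory (hf : Measurable (Function.uncurry f)) {g : S → ℝ≥0∞}
    (hg : Measurable g) :
    ∫⁻ ω, ∑' t, g (trajectory f x ω t) ∂Measure.infinitePi (fun _ : ℕ ↦ μ) =
      ∫⁻ σ, g σ ∂occupation μ f x := by
  rw [lintegral_occupation hf hg]
  exact lintegral_tsum fun t ↦ (hg.comp (measurable_trajectory hf x t)).aemeasurable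

theorem occupation_apply (hf : Measurable (Function.uncurry f)) {A : Set S}
    (hA : MeasurableSet A) :
    occupation μ f x A =
      ∑' t, Measure.infinitePi (fun _ : ℕ ↦ μ) {ω | trajectory f x ω t ∈ A} := by
  rw [occupation, Measure.sum_apply _ hA]
  exact tsum_congr fun t ↦ Measure.map_apply (measurable_trajectory hf x t) hA

theorem ae_occupation_of_forall_trajectory (hf : Measurable (Function.uncurry f)) {A : Set S}
    (hA : MeasurableSet A) (h : ∀ ω t, trajectory f x ω t ∈ A) :
    ∀ᵐ σ ∂occupation μ f x, σ ∈ A := by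
  refine mem_ae_iff.2 ?_
  simp [occupation_apply hf hA.compl, h]

theorem infinitePi_exists_trajectory_mem (hf : Measurable (Function.uncurry f)) {A : Set S}
    (hA : MeasurableSet A) (h : ∀ ω, {t | trajectory f x ω t ∈ A}.Subsingleton) :
    Measure.infinitePi (fun _ : ℕ ↦ μ) {ω | ∃ t, trajectory f x ω t ∈ A} =
      occupation μ f x A := by
  rw [occupation_apply hf hA, Set.ofPred_exists, measure_iUnion]
  · exact fun s t hst ↦ Set.disjoint_left.2 fun ω hs ht ↦ hst (h ω hs ht)
  · exact fun t ↦ measurable_trajectory hf x t hA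

variable [IsProbabilityMeasure μ]

theorem indepFun_eval_trajectory (hf : Measurable (Function.uncurry f)) (x : S) (t : ℕ) :
    IndepFun (fun ω ↦ ω t) (fun ω ↦ trajectory f x ω t) (Measure.infinitePi fun _ : ℕ ↦ μ) := by
  obtain ⟨F, hF, h⟩ := exists_trajectory_eq_restrict hf x t
  have hindep : iIndepFun (fun (i : ℕ) (ω : ℕ → D) ↦ ω i) (Measure.infinitePi fun _ ↦ μ) :=
    iIndepFun_infinitePi (X := fun _ d ↦ d) fun _ ↦ measurable_id
  have hsplit := hindep.indepFun_finset {t} (Finset.range t) (by simp) measurable_pi_apply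
  simp only [h]
  exact hsplit.comp (measurable_pi_apply ⟨t, Finset.mem_singleton_self t⟩) hF

theorem lintegral_trajectory_succ (hf : Measurable (Function.uncurry f)) (t : ℕ) {g : S → ℝ≥0∞}
    (hg : Measurable g) :
    ∫⁻ ω, g (trajectory f x ω (t + 1)) ∂Measure.infinitePi (fun _ : ℕ ↦ μ) =
      ∫⁻ ω, ∫⁻ d, g (f d (trajectory f x ω t)) ∂μ ∂Measure.infinitePi (fun _ : ℕ ↦ μ) := by
  set P := Measure.infinitePi fun _ : ℕ ↦ μ
  have hX := measurable_trajectory hf x t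
  have hgf : Measurable fun p : D × S ↦ g (f p.1 p.2) := hg.comp hf
  have hprod : P.map (fun ω ↦ (ω t, trajectory f x ω t)) =
      μ.prod (P.map fun ω ↦ trajectory f x ω t) := by
    rw [(indepFun_eval_trajectory hf x t).map_prod_eq_prod_map_map
      (measurable_pi_apply t).aemeasurable hX.aemeasurable, Measure.infinitePi_map_eval]
  calc ∫⁻ ω, g (f (ω t) (trajectory f x ω t)) ∂P
      = ∫⁻ p, g (f p.1 p.2) ∂P.map (fun ω ↦ (ω t, trajectory f x ω t)) :=
        (lintegral_map hgf ((measurable_pi_apply t).prodMk hX)).symm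
    _ = ∫⁻ σ, ∫⁻ d, g (f d σ) ∂μ ∂P.map fun ω ↦ trajectory f x ω t := by
        rw [hprod, lintegral_prod_symm' _ hgf]
    _ = ∫⁻ ω, ∫⁻ d, g (f d (trajectory f x ω t)) ∂μ ∂P :=
        lintegral_map hgf.lintegral_prod_left' hX

theorem lintegral_occupation_eq_add (hf : Measurable (Function.uncurry f)) {g : S → ℝ≥0∞}
    (hg : Measurable g) :
    ∫⁻ σ, g σ ∂occupation μ f x = g x + ∫⁻ σ, ∫⁻ d, g (f d σ) ∂μ ∂occupation μ f x := by
  have hmean : Measurable fun σ ↦ ∫⁻ d, g (f d σ) ∂μ := (hg.comp hf).lintegral_prod_left'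
  rw [lintegral_occupation hf hg, lintegral_occupation hf hmean,
    tsum_eq_zero_add' ENNReal.summable]
  simp only [lintegral_trajectory_succ hf _ hg]
  simp [trajectory]

theorem occupation_eq_lintegral_of_notMem (hf : Measurable (Function.uncurry f)) {A : Set S}
    (hA : MeasurableSet A) (hx : x ∉ A) :
    occupation μ f x A = ∫⁻ σ, μ {d | f d σ ∈ A} ∂occupation μ f x := by
  have h (σ : S) : ∫⁻ d, A.indicator 1 (f d σ) ∂μ = μ {d | f d σ ∈ A} :=
    lintegral_indicator_one ((hf.comp measurable_prodMk_right) hA)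
  rw [← lintegral_indicator_one hA, lintegral_occupation_eq_add hf (measurable_one.indicator hA)]
  simp [hx, h]

theorem occupation_singleton_of_eq_iff [MeasurableSingletonClass S]
    (hf : Measurable (Function.uncurry f)) {y₀ : S} {E : Set D}
    (h : ∀ d σ, f d σ = y ↔ σ = y₀ ∧ d ∈ E) (hy : y ≠ x) :
    occupation μ f x {y} = μ E * occupation μ f x {y₀} := by
  have hint (σ : S) : μ {d | f d σ ∈ ({y} : Set S)} = ({y₀} : Set S).indicator (fun _ ↦ μ E) σ := by
    by_cases hσ : σ = y₀ <;> simp [h, hσ]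
  rw [occupation_eq_lintegral_of_notMem hf (measurableSet_singleton y) hy.symm]
  simp only [hint, lintegral_indicator_const (measurableSet_singleton y₀)]

theorem occupation_singleton_eq_of_eq_iff [MeasurableSingletonClass S]
    (hf : Measurable (Function.uncurry f)) {y₀ : S} (h : ∀ d σ, f d σ = y ↔ σ = y₀) (hy : y ≠ x) :
    occupation μ f x {y} = occupation μ f x {y₀} := by
  simpa using occupation_singleton_of_eq_iff (μ := μ) hf (E := Set.univ) (by simpa using h) hy

theorem occupation_le_of_mem_of_apply_mem (hf : Measurable (Function.uncurry f)) {A B : Set S}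
    (hA : MeasurableSet A) (hB : MeasurableSet B) (hx : x ∉ B)
    (h : ∀ d σ, f d σ ∈ B → σ ∈ A) : occupation μ f x B ≤ occupation μ f x A := by
  rw [occupation_eq_lintegral_of_notMem hf hB hx, ← lintegral_indicator_one hA]
  refine lintegral_mono fun σ ↦ ?_
  by_cases hσ : σ ∈ A
  · simpa [hσ] using prob_le_one
  · simp [hσ, fun d ↦ mt (h d σ) hσ]

end RandomIteration

/-! ### Colour-pointed trees and grafts -/

/-- The underlying tree of a tree with a pointed node. -/
def PointedTree.tree (v : PointedTree) : MTree := v.context.plug v.subtree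

theorem Context.numNodes_plug_add (c : Context) (t t' : MTree) :
    (c.plug t).numNodes + t'.numNodes = (c.plug t').numNodes + t.numNodes := by
  induction c generalizing t t' with
  | nil => simp [plug, add_comm]
  | cons f c ih =>
    have := ih (f.father t) (f.father t')
    cases f <;> grind [plug, Frame.father, MTree.numNodes]

/-- The pointed leaf with context `c`, blue if `b` and red otherwise. -/
def coloredLeaf : Bool → Context → ColorPointedTree
  | true => .blue
  | false => .red

theorem tree_coloredLeaf (b : Bool) (c : Context) :
    (coloredLeaf b c).tree = c.plug .leaf := by
  cases b <;> rfl

theorem numNodes_tree_graft1 (P : ColorPointedTree) :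
    (graft1 P).tree.numNodes = P.tree.numNodes + 1 := by
  rcases P with c | c | ⟨c, t⟩
  · have := c.numNodes_plug_add (.unary .leaf) .leaf
    grind [graft1, ColorPointedTree.tree, Context.plug, Frame.father, MTree.numNodes]
  · have := c.numNodes_plug_add (.unary .leaf) .leaf
    grind [graft1, ColorPointedTree.tree, Context.plug, Frame.father, MTree.numNodes]
  · have := c.numNodes_plug_add (.binary t .leaf) (.unary t)
    grind [graft1, ColorPointedTree.tree, Context.plug, Frame.father, MTree.numNodes]

theorem Graft.numNodes_tree_apply (g : Graft) (v : PointedTree) :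
    (g.apply v).tree.numNodes = v.tree.numNodes + g.added := by
  rcases v with ⟨c, t⟩
  have hunary := c.numNodes_plug_add (.unary t) t
  have hleft := c.numNodes_plug_add (.binary t .leaf) t
  have hright := c.numNodes_plug_add (.binary .leaf t) t
  cases g <;> grind [apply, PointedTree.tree, ColorPointedTree.tree, Context.plug, Frame.father,
    MTree.numNodes, added]

theorem graft1_injective : Function.Injective graft1 := by
  rintro (c | c | ⟨c, t⟩) (c' | c' | ⟨c', t'⟩) h <;> simp_all [graft1]

theorem Graft.apply_inj {g g' : Graft} {v v' : PointedTree} :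
    g.apply v = g'.apply v' ↔ g = g' ∧ v = v' := by
  rcases v with ⟨c, t⟩
  rcases v' with ⟨c', t'⟩
  cases g <;> cases g' <;> simp [apply, and_comm]

theorem graft1_ne_apply (P : ColorPointedTree) (g : Graft) (v : PointedTree) :
    graft1 P ≠ g.apply v := by
  rcases v with ⟨c, t⟩
  cases g <;> cases P <;> simp [graft1, Graft.apply]

theorem coloredLeaf_nil_ne_graft1 (b : Bool) (P : ColorPointedTree) :
    coloredLeaf b [] ≠ graft1 P := by
  cases b <;> cases P <;> simp [coloredLeaf, graft1]

theorem coloredLeaf_nil_ne_apply (b : Bool) (g : Graft) (v : PointedTree) :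
    coloredLeaf b [] ≠ g.apply v := by
  rcases v with ⟨c, t⟩
  cases b <;> cases g <;> simp [coloredLeaf, Graft.apply]

theorem ColorPointedTree.eq_coloredLeaf_or_graft (P : ColorPointedTree) :
    (∃ b, P = coloredLeaf b []) ∨ (∃ Q, P = graft1 Q) ∨ ∃ (g : Graft) (v : PointedTree),
      P = g.apply v := by
  rcases P with (_ | ⟨_ | t | t, c⟩) | (_ | ⟨_ | t | t, c⟩) | ⟨c, t⟩
  · exact .inl ⟨true, rfl⟩
  · exact .inr <| .inl ⟨.blue c, rfl⟩
  · exact .inr <| .inr ⟨.G5, ⟨c, t⟩, rfl⟩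
  · exact .inr <| .inr ⟨.G3, ⟨c, t⟩, rfl⟩
  · exact .inl ⟨false, rfl⟩
  · exact .inr <| .inl ⟨.red c, rfl⟩
  · exact .inr <| .inr ⟨.G4, ⟨c, t⟩, rfl⟩
  · exact .inr <| .inl ⟨.green c t, rfl⟩
  · exact .inr <| .inr ⟨.G2, ⟨c, t⟩, rfl⟩

theorem Graft.added_pos (g : Graft) : 0 < g.added := by cases g <;> simp [added]

theorem Graft.added_le_two (g : Graft) : g.added ≤ 2 := by cases g <;> simp [added]

theorem coloredLeaf_inj {b b' : Bool} {c c' : Context} :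
    coloredLeaf b c = coloredLeaf b' c' ↔ b = b' ∧ c = c' := by
  cases b <;> cases b' <;> simp [coloredLeaf]

theorem ColorPointedTree.eq_coloredLeaf_or_green (P : ColorPointedTree) :
    (∃ b c, P = coloredLeaf b c) ∨ ∃ c t, P = .green c t := by
  rcases P with c | c | ⟨c, t⟩
  · exact .inl ⟨true, c, rfl⟩
  · exact .inl ⟨false, c, rfl⟩
  · exact .inr ⟨c, t, rfl⟩

/-! ### Counting colour-pointed trees -/

theorem Context.plug_append_singleton (c : Context) (f : Frame) (t : MTree) :
    Context.plug (c ++ [f]) t = f.father (c.plug t) := by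
  induction c generalizing t with
  | nil => rfl
  | cons _ _ ih => exact ih _

/-- The node `v` of a tree, in the larger tree in which `f` tells how the former root hangs below
the new root. -/
def PointedTree.below (f : Frame) (v : PointedTree) : PointedTree := ⟨v.context ++ [f], v.subtree⟩

theorem PointedTree.tree_below (f : Frame) (v : PointedTree) :
    (v.below f).tree = f.father v.tree := v.context.plug_append_singleton f v.subtree

theorem PointedTree.below_inj {f f' : Frame} {v v' : PointedTree} :
    v.below f = v'.below f' ↔ f = f' ∧ v = v' := by
  rcases v with ⟨c, t⟩
  rcases v' with ⟨c', t'⟩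
  simp only [below, PointedTree.mk.injEq, List.append_singleton_inj]
  tauto

theorem PointedTree.below_ne_root (f : Frame) (v : PointedTree) (t : MTree) :
    v.below f ≠ ⟨[], t⟩ := by
  simp [below]

/-- The nodes of a tree. -/
def MTree.nodes : MTree → List PointedTree
  | .leaf => [⟨[], .leaf⟩]
  | .unary t => ⟨[], .unary t⟩ :: t.nodes.map (.below .only)
  | .binary l r =>
      ⟨[], .binary l r⟩ :: (l.nodes.map (.below (.left r)) ++ r.nodes.map (.below (.right l)))

theorem length_nodes (T : MTree) : T.nodes.length = T.numNodes := by
  induction T with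
  | leaf => rfl
  | unary t ih => simp [MTree.nodes, MTree.numNodes, ih]
  | binary l r ihl ihr => simp [MTree.nodes, MTree.numNodes, ihl, ihr]

theorem nodup_nodes (T : MTree) : T.nodes.Nodup := by
  have hinj (f : Frame) : Function.Injective (PointedTree.below f) :=
    fun _ _ h ↦ (PointedTree.below_inj.1 h).2
  induction T with
  | leaf => simp [MTree.nodes]
  | unary t ih => simp [MTree.nodes, PointedTree.below_ne_root, ih.map (hinj _)]
  | binary l r ihl ihr =>
    simp [MTree.nodes, PointedTree.below_ne_root, List.nodup_append, PointedTree.below_inj,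
      ihl.map (hinj _), ihr.map (hinj _)]

theorem mem_nodes {v : PointedTree} {T : MTree} : v ∈ T.nodes ↔ v.tree = T := by
  constructor
  · intro hv
    induction T generalizing v with
    | leaf => simp_all [MTree.nodes, PointedTree.tree, Context.plug]
    | unary t ih =>
      obtain rfl | ⟨w, hw, rfl⟩ : v = _ ∨ ∃ w ∈ t.nodes, w.below _ = v := by
        simpa [MTree.nodes] using hv
      · rfl
      · rw [PointedTree.tree_below, ih hw, Frame.father]
    | binary l r ihl ihr =>
      obtain rfl | ⟨w, hw, rfl⟩ | ⟨w, hw, rfl⟩ :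
          v = _ ∨ (∃ w ∈ l.nodes, w.below _ = v) ∨ ∃ w ∈ r.nodes, w.below _ = v := by
        simpa [MTree.nodes] using hv
      · rfl
      · rw [PointedTree.tree_below, ihl hw, Frame.father]
      · rw [PointedTree.tree_below, ihr hw, Frame.father]
  · rintro rfl
    rcases v with ⟨c, t⟩
    induction c using List.reverseRecOn with
    | nil => cases t <;> simp [MTree.nodes, PointedTree.tree, Context.plug]
    | append_singleton c f ih =>
      change PointedTree.below f ⟨c, t⟩ ∈ (PointedTree.below f ⟨c, t⟩).tree.nodes
      rw [PointedTree.tree_below]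
      cases f <;> simp [Frame.father, MTree.nodes, PointedTree.below_inj, ih]

/-- The coloured node of a colour-pointed tree, without its colour. -/
def ColorPointedTree.node : ColorPointedTree → PointedTree
  | .blue c => ⟨c, .leaf⟩
  | .red c => ⟨c, .leaf⟩
  | .green c t => ⟨c, .unary t⟩

/-- The colour-pointed trees that arise by colouring a node. -/
def PointedTree.colors : PointedTree → List ColorPointedTree
  | ⟨c, .leaf⟩ => [.blue c, .red c]
  | ⟨c, .unary t⟩ => [.green c t]
  | ⟨_, .binary _ _⟩ => []

theorem mem_colors {P : ColorPointedTree} {v : PointedTree} : P ∈ v.colors ↔ P.node = v := by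
  rcases v with ⟨c, _ | _ | _⟩ <;> cases P <;>
    simp [PointedTree.colors, ColorPointedTree.node, eq_comm]

theorem nodup_colors (v : PointedTree) : v.colors.Nodup := by
  rcases v with ⟨c, _ | _ | _⟩ <;> simp [PointedTree.colors]

/-- The colour-pointed trees with underlying tree `T`. -/
def MTree.colorings (T : MTree) : List ColorPointedTree := T.nodes.flatMap PointedTree.colors

theorem mem_colorings {P : ColorPointedTree} {T : MTree} : P ∈ T.colorings ↔ P.tree = T := by
  have htree : P.node.tree = P.tree := by cases P <;> rfl
  simp [MTree.colorings, mem_nodes, mem_colors, htree]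

theorem nodup_colorings (T : MTree) : T.colorings.Nodup := by
  refine List.nodup_flatMap.2 ⟨fun v _ ↦ nodup_colors v, ?_⟩
  refine (nodup_nodes T).imp fun {v w} hvw P hv hw ↦ ?_
  exact hvw ((mem_colors.1 hv).symm.trans (mem_colors.1 hw))

theorem length_colorings (T : MTree) : T.colorings.length = T.numNodes + 1 := by
  have hbelow (f : Frame) (v : PointedTree) : (v.below f).colors.length = v.colors.length := by
    rcases v with ⟨c, _ | _ | _⟩ <;> rfl
  have hsum (T : MTree) : (T.nodes.map fun v ↦ v.colors.length).sum = T.numNodes + 1 := by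
    induction T with
    | leaf => rfl
    | unary t ih =>
      simp only [MTree.nodes, MTree.numNodes, List.map_cons, List.map_map, Function.comp_def,
        hbelow, List.sum_cons, ih]
      simp only [PointedTree.colors, List.length_singleton]
      lia
    | binary l r ihl ihr =>
      simp only [MTree.nodes, MTree.numNodes, List.map_cons, List.map_append, List.map_map,
        Function.comp_def, hbelow, List.sum_cons, List.sum_append, ihl, ihr]
      simp only [PointedTree.colors, List.length_nil]
      lia
  rw [MTree.colorings, List.length_flatMap, hsum]

theorem MTree.numNodes_pos (T : MTree) : 0 < T.numNodes := by
  cases T <;> simp [MTree.numNodes]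

theorem finite_setOf_numNodes_le (n : ℕ) : {T : MTree | T.numNodes ≤ n}.Finite := by
  induction n with
  | zero => simp [(MTree.numNodes_pos _).ne']
  | succ n ih =>
    refine ((Set.finite_singleton MTree.leaf).union
      ((ih.image .unary).union (ih.image2 .binary ih))).subset ?_
    rintro (_ | t | ⟨l, r⟩) h <;> simp [MTree.numNodes] at h ⊢ <;> lia

/-- The trees of size `n`. -/
noncomputable def treesOfSize (n : ℕ) : Finset MTree :=
  ((finite_setOf_numNodes_le n).subset fun _ (h : _ = n) ↦ h.le :
    {T : MTree | T.numNodes = n}.Finite).toFinset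

theorem mem_treesOfSize {n : ℕ} {T : MTree} : T ∈ treesOfSize n ↔ T.numNodes = n := by
  simp [treesOfSize]

theorem natCard_numNodes_eq (n : ℕ) :
    Nat.card {T : MTree // T.numNodes = n} = (treesOfSize n).card :=
  Nat.subtype_card _ fun _ ↦ mem_treesOfSize

theorem card_treesOfSize_zero : (treesOfSize 0).card = 0 := by
  simp [Finset.eq_empty_iff_forall_notMem, mem_treesOfSize, (MTree.numNodes_pos _).ne']

theorem card_treesOfSize_one : (treesOfSize 1).card = 1 := by
  refine Finset.card_eq_one.2 ⟨.leaf, Finset.ext ?_⟩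
  rintro (_ | t | ⟨l, r⟩) <;>
    simp [mem_treesOfSize, MTree.numNodes, (MTree.numNodes_pos _).ne']

open scoped Classical in
/-- The colour-pointed trees of size `n`. -/
noncomputable def colorPointedTreesOfSize (n : ℕ) : Finset ColorPointedTree :=
  (treesOfSize n).biUnion fun T ↦ T.colorings.toFinset

open scoped Classical in
/-- The trees of size `n` with a pointed node. -/
noncomputable def pointedTreesOfSize (n : ℕ) : Finset PointedTree :=
  (treesOfSize n).biUnion fun T ↦ T.nodes.toFinset

theorem mem_colorPointedTreesOfSize {n : ℕ} {P : ColorPointedTree} :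
    P ∈ colorPointedTreesOfSize n ↔ P.tree.numNodes = n := by
  simp [colorPointedTreesOfSize, mem_treesOfSize, mem_colorings]

theorem mem_pointedTreesOfSize {n : ℕ} {v : PointedTree} :
    v ∈ pointedTreesOfSize n ↔ v.tree.numNodes = n := by
  simp [pointedTreesOfSize, mem_treesOfSize, mem_nodes]

theorem card_biUnion_treesOfSize {α : Type*} [DecidableEq α] {l : MTree → List α}
    {tree : α → MTree} (hmem : ∀ {T a}, a ∈ l T ↔ tree a = T) (hnodup : ∀ T, (l T).Nodup)
    {n k : ℕ} (hlength : ∀ T, T.numNodes = n → (l T).length = k) :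
    ((treesOfSize n).biUnion fun T ↦ (l T).toFinset).card = k * (treesOfSize n).card := by
  rw [Finset.card_biUnion, Finset.sum_const_nat (m := k), mul_comm]
  · intro T hT
    rw [List.toFinset_card_of_nodup (hnodup T), hlength T (mem_treesOfSize.1 hT)]
  · intro T _ T' _ hne
    refine Finset.disjoint_left.2 fun a h h' ↦ hne ?_
    rw [← hmem.1 (List.mem_toFinset.1 h), hmem.1 (List.mem_toFinset.1 h')]

theorem card_colorPointedTreesOfSize (n : ℕ) :
    (colorPointedTreesOfSize n).card = (n + 1) * (treesOfSize n).card := by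
  classical
  exact card_biUnion_treesOfSize mem_colorings nodup_colorings
    fun T hT ↦ by rw [length_colorings, hT]

theorem card_pointedTreesOfSize (n : ℕ) :
    (pointedTreesOfSize n).card = n * (treesOfSize n).card := by
  classical
  exact card_biUnion_treesOfSize mem_nodes nodup_nodes
    fun T hT ↦ by rw [length_nodes, hT]

instance : DecidableEq Graft := Function.Injective.decidableEq (f := Graft.ctorIdx) (by
  rintro (_ | _) (_ | _) <;> simp [Graft.ctorIdx])

instance : Fintype Graft := ⟨{.G2, .G3, .G4, .G5}, by rintro (_ | _) <;> simp⟩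

theorem sum_card_pointedTreesOfSize_sub_added (n : ℕ) :
    ∑ g : Graft, (pointedTreesOfSize (n + 2 - g.added)).card =
      (pointedTreesOfSize (n + 1)).card + 3 * (pointedTreesOfSize n).card := by
  have huniv : (Finset.univ : Finset Graft) = {.G2, .G3, .G4, .G5} := rfl
  rw [huniv, Finset.sum_insert (by simp), Finset.sum_insert (by simp),
    Finset.sum_pair (by simp)]
  simp only [Graft.added]
  lia

theorem card_colorPointedTreesOfSize_add_two (n : ℕ) :
    (colorPointedTreesOfSize (n + 2)).card = (colorPointedTreesOfSize (n + 1)).card +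
      (pointedTreesOfSize (n + 1)).card + 3 * (pointedTreesOfSize n).card := by
  classical
  let graft : ColorPointedTree ⊕ (Σ _ : Graft, PointedTree) → ColorPointedTree :=
    Sum.elim graft1 fun x ↦ x.1.apply x.2
  have hinjective : Function.Injective graft := by
    rintro (P | ⟨g, v⟩) (P' | ⟨g', v'⟩) h
    · exact congrArg _ (graft1_injective h)
    · exact absurd h (graft1_ne_apply _ _ _)
    · exact absurd h.symm (graft1_ne_apply _ _ _)
    · obtain ⟨rfl, rfl⟩ := Graft.apply_inj.1 h
      rfl
  have himage : colorPointedTreesOfSize (n + 2) = ((colorPointedTreesOfSize (n + 1)).disjSum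
      (Finset.univ.sigma fun g : Graft ↦ pointedTreesOfSize (n + 2 - g.added))).image graft := by
    ext P
    have hadded := Graft.added_le_two
    simp only [mem_colorPointedTreesOfSize, Finset.mem_image, Sum.exists, Finset.inl_mem_disjSum,
      Finset.inr_mem_disjSum, Finset.mem_sigma, Finset.mem_univ, true_and, Sigma.exists,
      mem_pointedTreesOfSize, graft, Sum.elim_inl, Sum.elim_inr]
    constructor
    · intro hP
      obtain ⟨b, rfl⟩ | ⟨Q, rfl⟩ | ⟨g, v, rfl⟩ := P.eq_coloredLeaf_or_graft
      · simp [tree_coloredLeaf, Context.plug, MTree.numNodes] at hP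
      · rw [numNodes_tree_graft1] at hP
        exact .inl ⟨Q, by lia, rfl⟩
      · rw [Graft.numNodes_tree_apply] at hP
        exact .inr ⟨g, v, by lia, rfl⟩
    · rintro (⟨Q, hQ, rfl⟩ | ⟨g, v, hv, rfl⟩)
      · rw [numNodes_tree_graft1, hQ]
      · rw [Graft.numNodes_tree_apply, hv, Nat.sub_add_cancel (by grind)]
  rw [himage, Finset.card_image_of_injective _ hinjective, Finset.card_disjSum, Finset.card_sigma,
    sum_card_pointedTreesOfSize_sub_added, add_assoc]

/-! ### The probability that a try reaches a given size -/

/-- The expected number of visits that a try pays to a given colour-pointed tree of size `s`, as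
long as `s` is at most the target size. -/
noncomputable def weight (s : ℕ) : ℝ≥0 := 3 / 2 * 3⁻¹ ^ s

/-- The probability that a try reaches size `n`, as long as `n` is at most the target size. -/
noncomputable def reach (n : ℕ) : ℝ≥0 := (colorPointedTreesOfSize n).card * weight n

theorem reach_zero : reach 0 = 0 := by
  simp [reach, card_colorPointedTreesOfSize, card_treesOfSize_zero]

theorem reach_one : reach 1 = 1 := by
  rw [reach, card_colorPointedTreesOfSize, card_treesOfSize_one, weight, ← NNReal.coe_inj]
  norm_num

theorem reach_add_two (n : ℕ) :
    3 * (n + 1) * (n + 2) * (reach (n + 2) : ℝ) =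
      (n + 1) * (2 * n + 3) * reach (n + 1) + n * (n + 2) * reach n := by
  have hcard : ((n + 3) * (treesOfSize (n + 2)).card : ℝ) =
      (2 * n + 3) * (treesOfSize (n + 1)).card + 3 * n * (treesOfSize n).card := by
    have hrec := card_colorPointedTreesOfSize_add_two n
    simp only [card_colorPointedTreesOfSize, card_pointedTreesOfSize] at hrec
    exact_mod_cast hrec.trans (by ring)
  simp only [reach, weight, card_colorPointedTreesOfSize]
  push_cast
  linear_combination (n + 1) * (n + 2) * (1 / 2 * 3⁻¹ ^ n : ℝ) * hcard

-- `reach n` decreases like `n ^ (-1 / 2)`; the second bound, which makes it decrease at most like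
-- `n ^ (-2 / 3)`, keeps the sum of the `reach s` with `s ≤ n` comparable with `n * reach n`.
theorem reach_add_two_le_and_le (n : ℕ) :
    (reach (n + 2) : ℝ) ≤ reach (n + 1) ∧
      (3 * n + 2) * (reach (n + 1) : ℝ) ≤ (3 * n + 4) * reach (n + 2) := by
  induction n with
  | zero =>
    have := reach_add_two 0
    norm_num [reach_zero, reach_one] at this ⊢
    constructor <;> linarith
  | succ n ih =>
    obtain ⟨hupper, hlower⟩ := ih
    have hrec := reach_add_two (n + 1)
    have hpos : (0 : ℝ) < 3 * (n + 2) * (n + 3) := by positivity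
    push_cast at hrec ⊢
    constructor
    · have hnonneg : 0 ≤ (4 * n ^ 2 + 11 * n + 4) * (reach (n + 2) : ℝ) := by positivity
      have hcoeff : 0 < (3 * n + 2 : ℝ) := by positivity
      refine le_of_mul_le_mul_left ?_ (mul_pos hcoeff hpos)
      linear_combination (3 * n + 2) * hrec + (n + 1) * (n + 3) * hlower + hnonneg
    · have hnonneg : 0 ≤ (n + 1) * (reach (n + 2) : ℝ) := by positivity
      refine le_of_mul_le_mul_left ?_ hpos
      linear_combination (3 * n + 7) * ((n + 1) * (n + 3) * hupper - hrec) + hnonneg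

theorem sum_reach_le (n : ℕ) :
    ∑ s ∈ Finset.range (n + 2), reach s ≤ (3 * n + 2) * reach (n + 1) := by
  induction n with
  | zero => simp [Finset.sum_range_succ, reach_zero, reach_one]
  | succ n ih =>
    rw [Finset.sum_range_succ, ← NNReal.coe_le_coe]
    have hlower := (reach_add_two_le_and_le n).2
    rw [← NNReal.coe_le_coe] at ih
    push_cast at ih ⊢
    linarith

/-! ### The steps of the sampler -/

/-- The side of the node with context `c` below its father: `true` for a left child, `false` for a
right child, undefined for an only child. The root counts as a right child. -/
def Context.side : Context → Option Bool
  | [] => some false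
  | .only :: _ => none
  | .left _ :: _ => some true
  | .right _ :: _ => some false

/-- Repointing from a pointed leaf: `v` moves up until it is a left child if `b` (blue leaf), a
right child otherwise (red leaf); then `g` is applied. -/
def seek : Bool → Graft → PointedTree → ℕ → State
  | true => .seekLeft
  | false => .seekRight

theorem State.cases_seek {p : State → Prop} (start : p .start) (loop : ∀ P s, p (.loop P s))
    (seek : ∀ b g v s, p (seek b g v s)) (returned : ∀ r, p (.returned r))
    (done : ∀ P, p (.done P)) (σ : State) : p σ := by
  rcases σ with _ | ⟨P, s⟩ | ⟨g, v, s⟩ | ⟨g, v, s⟩ | r | P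
  exacts [start, loop P s, seek true g v s, seek false g v s, returned r, done P]

theorem seek_inj {b b' : Bool} {g g' : Graft} {v v' : PointedTree} {s s' : ℕ} :
    seek b g v s = seek b' g' v' s' ↔ b = b' ∧ g = g' ∧ v = v' ∧ s = s' := by
  cases b <;> cases b' <;> simp [seek]

theorem seek_ne_start (b : Bool) (g : Graft) (v : PointedTree) (s : ℕ) : seek b g v s ≠ .start := by
  cases b <;> simp [seek]

theorem seek_ne_loop (b : Bool) (g : Graft) (v : PointedTree) (s : ℕ) (P : ColorPointedTree)
    (s' : ℕ) : seek b g v s ≠ .loop P s' := by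
  cases b <;> simp [seek]

theorem seek_ne_returned (b : Bool) (g : Graft) (v : PointedTree) (s : ℕ)
    (r : Option (ColorPointedTree × ℕ)) : seek b g v s ≠ .returned r := by
  cases b <;> simp [seek]

theorem seek_ne_done (b : Bool) (g : Graft) (v : PointedTree) (s : ℕ) (P : ColorPointedTree) :
    seek b g v s ≠ .done P := by
  cases b <;> simp [seek]

theorem step_start (n : ℕ) (d : Draw) : step n d .start = .loop (coloredLeaf d.1 []) 1 := by
  cases hd : d.1 <;> simp [step, hd, coloredLeaf]

section Step

variable {n s : ℕ} {d : Draw} {g : Graft}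

theorem step_loop_of_le (h : n ≤ s) (P : ColorPointedTree) :
    step n d (.loop P s) = .returned (some (P, s)) := by
  simp [step, h.not_gt]

theorem step_loop_graft1 (h : s < n) (hd : chooseGraft d.2 = none) (P : ColorPointedTree) :
    step n d (.loop P s) = .loop (graft1 P) (s + 1) := by
  simp [step, h, hd]

theorem step_loop_coloredLeaf (h : s < n) (hd : chooseGraft d.2 = some g) (b : Bool)
    (c : Context) : step n d (.loop (coloredLeaf b c) s) = seek b g ⟨c, .leaf⟩ s := by
  cases b <;> simp [step, h, hd, coloredLeaf, seek]

theorem step_loop_green (h : s < n) (hd : chooseGraft d.2 = some g) (c : Context) (t : MTree) :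
    step n d (.loop (.green c t) s) = .loop (g.apply ⟨.only :: c, t⟩) (s + g.added) := by
  simp [step, h, hd]

theorem step_seek_of_side_eq {b : Bool} {v : PointedTree} (h : v.context.side = some b) :
    step n d (seek b g v s) = .loop (g.apply v) (s + g.added) := by
  rcases v with ⟨_ | ⟨_ | _ | _, c⟩, t⟩ <;> cases b <;> simp_all [Context.side, step, seek]

theorem step_seek_of_side_ne {b : Bool} {f : Frame} {c : Context}
    (h : Context.side (f :: c) ≠ some b) (t : MTree) :
    step n d (seek b g ⟨f :: c, t⟩ s) = seek b g ⟨c, f.father t⟩ s := by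
  cases f <;> cases b <;> simp_all [Context.side, step, seek]

theorem step_seek_nil_of_side_ne {b : Bool} (h : Context.side [] ≠ some b) (t : MTree) :
    step n d (seek b g ⟨[], t⟩ s) = .returned none := by
  cases b <;> simp_all [Context.side, step, seek]

end Step

theorem Frame.father_inj_of_side_ne {f f' : Frame} {c : Context} {t t' : MTree} {b : Bool}
    (h : Context.side (f :: c) ≠ some b) (h' : Context.side (f' :: c) ≠ some b) :
    f.father t = f'.father t' ↔ f = f' ∧ t = t' := by
  cases b <;> cases f <;> cases f' <;> simp_all [Context.side, Frame.father, and_comm]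

theorem Frame.father_ne_leaf (f : Frame) (t : MTree) : f.father t ≠ .leaf := by
  cases f <;> simp [Frame.father]

theorem step_cases {n : ℕ} {d : Draw} {p : State → State → Prop}
    (start : p .start (.loop (coloredLeaf d.1 []) 1))
    (exit : ∀ P s, n ≤ s → p (.loop P s) (.returned (some (P, s))))
    (graft1 : ∀ P s, s < n → chooseGraft d.2 = none → p (.loop P s) (.loop (graft1 P) (s + 1)))
    (leaf : ∀ b c s g, s < n → chooseGraft d.2 = some g →
      p (.loop (coloredLeaf b c) s) (seek b g ⟨c, .leaf⟩ s))
    (green : ∀ c t s g, s < n → chooseGraft d.2 = some g →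
      p (.loop (.green c t) s) (.loop (g.apply ⟨.only :: c, t⟩) (s + g.added)))
    (apply : ∀ b g v s, v.context.side = some b →
      p (seek b g v s) (.loop (g.apply v) (s + g.added)))
    (up : ∀ b g f c t s, Context.side (f :: c) ≠ some b →
      p (seek b g ⟨f :: c, t⟩ s) (seek b g ⟨c, f.father t⟩ s))
    (fail : ∀ b g t s, Context.side [] ≠ some b → p (seek b g ⟨[], t⟩ s) (.returned none))
    (restart : p (.returned none) .start)
    (reject : ∀ P, p (.returned (some (P, n + 1))) .start)
    (accept : ∀ P s, s ≠ n + 1 → p (.returned (some (P, s))) (.done P))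
    (done : ∀ P, p (.done P) (.done P)) (σ : State) : p σ (step n d σ) := by
  induction σ using State.cases_seek with
  | start => rwa [step_start]
  | loop P s =>
    by_cases hs : s < n
    · rcases hd : chooseGraft d.2 with _ | g
      · rw [step_loop_graft1 hs hd]
        exact graft1 P s hs hd
      · obtain ⟨b, c, rfl⟩ | ⟨c, t, rfl⟩ := P.eq_coloredLeaf_or_green
        · rw [step_loop_coloredLeaf hs hd]
          exact leaf b c s g hs hd
        · rw [step_loop_green hs hd]
          exact green c t s g hs hd
    · rw [step_loop_of_le (not_lt.1 hs)]
      exact exit P s (not_lt.1 hs)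
  | seek b g v s =>
    by_cases hv : v.context.side = some b
    · rw [step_seek_of_side_eq hv]
      exact apply b g v s hv
    · rcases v with ⟨_ | ⟨f, c⟩, t⟩
      · rw [step_seek_nil_of_side_ne hv]
        exact fail b g t s hv
      · rw [step_seek_of_side_ne hv]
        exact up b g f c t s hv
  | returned r =>
    rcases r with _ | ⟨P, s⟩
    · exact restart
    · by_cases hs : s = n + 1
      · simpa [step, hs] using reject P
      · simpa [step, hs] using accept P s hs
  | done P => exact done P

section Inversion

variable {n s : ℕ} {d : Draw} {σ : State} {g : Graft}

theorem step_eq_loop_coloredLeaf_nil_iff {b : Bool} :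
    step n d σ = .loop (coloredLeaf b []) 1 ↔ σ = .start ∧ d.1 = b := by
  constructor
  · apply step_cases (p := fun σ τ ↦ τ = _ → σ = _ ∧ _) <;>
      grind [seek_ne_loop, coloredLeaf_inj, coloredLeaf_nil_ne_graft1, coloredLeaf_nil_ne_apply]
  · rintro ⟨rfl, rfl⟩
    exact step_start n d

theorem step_eq_loop_graft1_iff (hs : s < n) {P : ColorPointedTree} :
    step n d σ = .loop (graft1 P) (s + 1) ↔ σ = .loop P s ∧ chooseGraft d.2 = none := by
  constructor
  · apply step_cases (p := fun σ τ ↦ τ = _ → σ = _ ∧ _) <;>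
      grind [seek_ne_loop, coloredLeaf_nil_ne_graft1, graft1_ne_apply, graft1_injective.eq_iff]
  · rintro ⟨rfl, hd⟩
    exact step_loop_graft1 hs hd P

theorem step_eq_loop_apply_iff_green (hs : s < n) {c : Context} {t : MTree} :
    step n d σ = .loop (g.apply ⟨.only :: c, t⟩) (s + g.added) ↔
      σ = .loop (.green c t) s ∧ chooseGraft d.2 = some g := by
  constructor
  · apply step_cases (p := fun σ τ ↦ τ = _ → σ = _ ∧ _) <;>
      grind [seek_ne_loop, coloredLeaf_nil_ne_apply, graft1_ne_apply, Graft.apply_inj, Context.side]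
  · rintro ⟨rfl, hd⟩
    exact step_loop_green hs hd c t

theorem step_eq_loop_apply_iff_seek {b : Bool} {v : PointedTree} (hv : v.context.side = some b) :
    step n d σ = .loop (g.apply v) (s + g.added) ↔ σ = seek b g v s := by
  constructor
  · apply step_cases (p := fun σ τ ↦ τ = _ → σ = _) <;>
      grind [seek_ne_loop, coloredLeaf_nil_ne_apply, graft1_ne_apply, Graft.apply_inj, Context.side]
  · rintro rfl
    exact step_seek_of_side_eq hv

theorem step_eq_seek_leaf_iff (hs : s < n) {b : Bool} {c : Context} :
    step n d σ = seek b g ⟨c, .leaf⟩ s ↔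
      σ = .loop (coloredLeaf b c) s ∧ chooseGraft d.2 = some g := by
  constructor
  · apply step_cases (p := fun σ τ ↦ τ = _ → σ = _ ∧ _) <;>
      grind [seek_inj, seek_ne_loop, seek_ne_start, seek_ne_returned, seek_ne_done,
        Frame.father_ne_leaf]
  · rintro ⟨rfl, hd⟩
    exact step_loop_coloredLeaf hs hd b c

theorem step_eq_seek_father_iff {b : Bool} {f : Frame} {c : Context} {t : MTree}
    (hf : Context.side (f :: c) ≠ some b) :
    step n d σ = seek b g ⟨c, f.father t⟩ s ↔ σ = seek b g ⟨f :: c, t⟩ s := by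
  constructor
  · apply step_cases (p := fun σ τ ↦ τ = _ → σ = _) <;>
      grind [seek_inj, seek_ne_loop, seek_ne_start, seek_ne_returned, seek_ne_done,
        Frame.father_ne_leaf, Frame.father_inj_of_side_ne]
  · rintro rfl
    exact step_seek_of_side_ne hf t

theorem step_eq_returned_some_iff {P : ColorPointedTree} :
    step n d σ = .returned (some (P, s)) ↔ σ = .loop P s ∧ n ≤ s := by
  constructor
  · apply step_cases (p := fun σ τ ↦ τ = _ → σ = _ ∧ _) <;>
      grind [seek_ne_returned]
  · rintro ⟨rfl, hs⟩
    exact step_loop_of_le hs P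

theorem eq_done_or_eq_returned_of_step_eq_done {P : ColorPointedTree} :
    step n d σ = .done P → σ = .done P ∨ ∃ s, σ = .returned (some (P, s)) ∧ s ≠ n + 1 := by
  apply step_cases (p := fun σ τ ↦ τ = .done P →
    σ = .done P ∨ ∃ s, σ = .returned (some (P, s)) ∧ s ≠ n + 1) <;>
    simp +contextual [seek_ne_done]

end Inversion

/-- The relation between the size counter and the current tree that holds at every time in a run
of the sampler for size `n`. -/
def State.Valid (n : ℕ) : State → Prop
  | .start => True
  | .loop P s => P.tree.numNodes = s ∧ s ≤ n + 1
  | .seekLeft _ v s => v.tree.numNodes = s ∧ s < n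
  | .seekRight _ v s => v.tree.numNodes = s ∧ s < n
  | .returned none => True
  | .returned (some (P, s)) => P.tree.numNodes = s ∧ n ≤ s ∧ s ≤ n + 1
  | .done P => P.tree.numNodes = n

theorem valid_seek_iff {n : ℕ} {b : Bool} {g : Graft} {v : PointedTree} {s : ℕ} :
    (seek b g v s).Valid n ↔ v.tree.numNodes = s ∧ s < n := by
  cases b <;> rfl

theorem State.Valid.step {n : ℕ} {σ : State} (d : Draw) :
    σ.Valid n → (step n d σ).Valid n := by
  have hadded := Graft.added_le_two
  apply step_cases (p := fun σ τ ↦ σ.Valid n → τ.Valid n) <;>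
    grind [State.Valid, valid_seek_iff, numNodes_tree_graft1, Graft.numNodes_tree_apply,
      tree_coloredLeaf, PointedTree.tree, ColorPointedTree.tree, Context.plug, Frame.father,
      MTree.numNodes]

/-! ### Expected numbers of visits -/

instance : MeasurableSpace State := ⊤

instance : DiscreteMeasurableSpace State := ⟨fun _ ↦ trivial⟩

theorem measurable_uncurry_step (n : ℕ) : Measurable (Function.uncurry (step n)) :=
  measurable_from_prod_countable_right fun _ ↦ .of_discrete

theorem trajectory_step (n : ℕ) (ω : Tape) (t : ℕ) :
    trajectory (step n) .start ω t = stateAt n ω t := by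
  induction t with
  | zero => rfl
  | succ t ih => rw [trajectory, stateAt, ih]

theorem valid_stateAt (n : ℕ) (ω : Tape) (t : ℕ) : (stateAt n ω t).Valid n := by
  induction t with
  | zero => trivial
  | succ t ih => exact ih.step _

/-- The occupation measure of the sampler for size `n`: it gives a set of states the expected
number of steps spent there. -/
noncomputable def visits (n : ℕ) : Measure State :=
  occupation (PMF.uniformOfFintype Draw).toMeasure (step n) .start

/-- The expected number of tries. -/
noncomputable def tries (n : ℕ) : ℝ≥0∞ := visits n {.start}

theorem ae_visits_valid (n : ℕ) : ∀ᵐ σ ∂visits n, σ.Valid n :=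
  ae_occupation_of_forall_trajectory (A := {σ | σ.Valid n}) (measurable_uncurry_step n)
    .of_discrete fun ω t ↦ (trajectory_step n ω t).symm ▸ valid_stateAt n ω t

theorem uniformOfFintype_toMeasure_setOf {α : Type*} [Fintype α] [Nonempty α] [MeasurableSpace α]
    [DiscreteMeasurableSpace α] (p : α → Prop) [DecidablePred p] :
    (PMF.uniformOfFintype α).toMeasure {a | p a} =
      (Finset.univ.filter p).card / Fintype.card α := by
  rw [PMF.toMeasure_uniformOfFintype_apply _ .of_discrete, ← Fintype.card_subtype]
  rfl

theorem uniformOfFintype_toMeasure_fst_eq (b : Bool) :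
    (PMF.uniformOfFintype Draw).toMeasure {d | d.1 = b} = 2⁻¹ := by
  have hcard : (Finset.univ.filter fun d : Draw ↦ d.1 = b).card = 9 := by cases b <;> decide
  rw [uniformOfFintype_toMeasure_setOf, hcard,
    ← ENNReal.toReal_eq_toReal_iff' (by finiteness) (by finiteness)]
  norm_num

theorem uniformOfFintype_toMeasure_chooseGraft_eq_none :
    (PMF.uniformOfFintype Draw).toMeasure {d | chooseGraft d.2 = none} = 3⁻¹ := by
  have hcard : (Finset.univ.filter fun d : Draw ↦ chooseGraft d.2 = none).card = 6 := by decide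
  rw [uniformOfFintype_toMeasure_setOf, hcard,
    ← ENNReal.toReal_eq_toReal_iff' (by finiteness) (by finiteness)]
  norm_num

theorem uniformOfFintype_toMeasure_chooseGraft_eq_some (g : Graft) :
    (PMF.uniformOfFintype Draw).toMeasure {d | chooseGraft d.2 = some g} = 3⁻¹ ^ g.added := by
  have hcard : (Finset.univ.filter fun d : Draw ↦ chooseGraft d.2 = some g).card =
      18 / 3 ^ g.added := by cases g <;> decide
  rw [uniformOfFintype_toMeasure_setOf, hcard,
    ← ENNReal.toReal_eq_toReal_iff' (by finiteness) (by finiteness)]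
  cases g <;> norm_num [Graft.added]

theorem visits_seek {n s : ℕ} (hs : s < n) {x : ℝ≥0∞}
    (hx : ∀ P : ColorPointedTree, P.tree.numNodes = s → visits n {.loop P s} = x)
    (b : Bool) (g : Graft) (c : Context) (t : MTree) (h : (c.plug t).numNodes = s) :
    visits n {seek b g ⟨c, t⟩ s} = 3⁻¹ ^ g.added * x := by
  have up {f : Frame} {c : Context} {t : MTree} (hf : Context.side (f :: c) ≠ some b) :
      visits n {seek b g ⟨c, f.father t⟩ s} = visits n {seek b g ⟨f :: c, t⟩ s} :=
    occupation_singleton_eq_of_eq_iff (measurable_uncurry_step n)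
      (fun _ _ ↦ step_eq_seek_father_iff hf) (seek_ne_start _ _ _ _)
  induction t generalizing c with
  | leaf =>
    rw [← hx (coloredLeaf b c) (by rwa [tree_coloredLeaf]),
      ← uniformOfFintype_toMeasure_chooseGraft_eq_some]
    exact occupation_singleton_of_eq_iff (measurable_uncurry_step n)
      (fun _ _ ↦ step_eq_seek_leaf_iff hs) (seek_ne_start _ _ _ _)
  | unary t ih => exact (up (f := .only) (by simp [Context.side])).trans (ih _ h)
  | binary l r ihl ihr =>
    -- Backwards in time, the point moves down, to the child on the side other than `b`.
    cases b with
    | true => exact (up (f := .right l) (by simp [Context.side])).trans (ihr _ h)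
    | false => exact (up (f := .left r) (by simp [Context.side])).trans (ihl _ h)

theorem coe_weight_one : (weight 1 : ℝ≥0∞) = 2⁻¹ := by
  rw [← ENNReal.coe_ofNat, ← ENNReal.coe_inv two_ne_zero, ENNReal.coe_inj, weight,
    ← NNReal.coe_inj]
  norm_num

theorem coe_weight_add (s k : ℕ) : (weight (s + k) : ℝ≥0∞) = 3⁻¹ ^ k * weight s := by
  have hweight : weight (s + k) = 3⁻¹ ^ k * weight s := by rw [weight, weight, pow_add]; ring
  rw [hweight, ENNReal.coe_mul, ENNReal.coe_pow, ENNReal.coe_inv three_ne_zero, ENNReal.coe_ofNat]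

theorem visits_loop {n s : ℕ} (hs : s ≤ n) (P : ColorPointedTree) (hP : P.tree.numNodes = s) :
    visits n {.loop P s} = weight s * tries n := by
  induction s using Nat.strong_induction_on generalizing P with
  | _ s ih =>
  have hstep := measurable_uncurry_step n
  obtain ⟨b, rfl⟩ | ⟨Q, rfl⟩ | ⟨g, v, rfl⟩ := P.eq_coloredLeaf_or_graft
  · obtain rfl : s = 1 := by rw [← hP, tree_coloredLeaf]; rfl
    rw [coe_weight_one, ← uniformOfFintype_toMeasure_fst_eq b]
    exact occupation_singleton_of_eq_iff hstep (fun _ _ ↦ step_eq_loop_coloredLeaf_nil_iff)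
      (by simp)
  · rw [numNodes_tree_graft1] at hP
    subst hP
    have hQ := ih _ (Nat.lt_succ_self _) (by lia) Q rfl
    rw [coe_weight_add, pow_one, mul_assoc, ← hQ, ← uniformOfFintype_toMeasure_chooseGraft_eq_none]
    exact occupation_singleton_of_eq_iff hstep (fun _ _ ↦ step_eq_loop_graft1_iff (by lia))
      (by simp)
  · rw [Graft.numNodes_tree_apply] at hP
    subst hP
    have hadded := g.added_pos
    have ih' := ih v.tree.numNodes (by lia) (by lia)
    rw [coe_weight_add, mul_assoc]
    rcases v with ⟨c, t⟩
    rcases hside : c.side with _ | b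
    · obtain ⟨c, rfl⟩ : ∃ c', c = .only :: c' := by
        rcases c with _ | ⟨_ | _ | _, c⟩ <;> simp_all [Context.side]
      rw [← ih' (.green c t) rfl, ← uniformOfFintype_toMeasure_chooseGraft_eq_some]
      exact occupation_singleton_of_eq_iff hstep
        (fun _ _ ↦ step_eq_loop_apply_iff_green (by lia)) (by simp)
    · rw [← visits_seek (by lia) ih' b g c t rfl]
      exact occupation_singleton_eq_of_eq_iff hstep
        (fun _ _ ↦ step_eq_loop_apply_iff_seek hside) (by simp)

/-! ### Output and running time -/

theorem exists_stateAt_eq_returned_of_done {n : ℕ} {ω : Tape} {P : ColorPointedTree} {t : ℕ}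
    (h : stateAt n ω t = .done P) : ∃ t, stateAt n ω t = .returned (some (P, n)) := by
  induction t with
  | zero => simp [stateAt] at h
  | succ t ih =>
    rcases eq_done_or_eq_returned_of_step_eq_done h with hdone | ⟨s, hreturned, hs⟩
    · exact ih hdone
    · have hvalid := valid_stateAt n ω t
      rw [hreturned] at hvalid
      obtain rfl : s = n := by grind [State.Valid]
      exact ⟨t, hreturned⟩

theorem stateAt_eq_done_of_lt {n : ℕ} {ω : Tape} {P : ColorPointedTree} {t t' : ℕ}
    (h : stateAt n ω t = .returned (some (P, n))) (ht : t < t') : stateAt n ω t' = .done P := by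
  induction t', ht using Nat.le_induction with
  | base => simp [stateAt, h, step]
  | succ t' _ ih => rw [stateAt, ih, step]

theorem exists_stateAt_eq_done_iff {n : ℕ} {ω : Tape} {P : ColorPointedTree} :
    (∃ t, stateAt n ω t = .done P) ↔ ∃ t, stateAt n ω t = .returned (some (P, n)) :=
  ⟨fun ⟨_, h⟩ ↦ exists_stateAt_eq_returned_of_done h,
    fun ⟨t, h⟩ ↦ ⟨t + 1, stateAt_eq_done_of_lt h t.lt_succ_self⟩⟩

theorem subsingleton_setOf_stateAt_eq_returned (n : ℕ) (ω : Tape) :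
    {t | ∃ P, stateAt n ω t = .returned (some (P, n))}.Subsingleton := by
  rintro t ⟨P, h⟩ t' ⟨P', h'⟩
  rcases lt_trichotomy t t' with hlt | rfl | hlt
  · simpa [h'] using stateAt_eq_done_of_lt h hlt
  · rfl
  · simpa [h] using stateAt_eq_done_of_lt h' hlt

theorem visits_biUnion_singleton {n : ℕ} {α : Type*} {F : α → State} (hF : F.Injective)
    {A : Finset α} {x : ℝ≥0∞} (h : ∀ a ∈ A, visits n {F a} = x) :
    visits n (⋃ a ∈ A, {F a}) = A.card * x := by
  rw [measure_biUnion_finset (fun a _ b _ hab ↦ Set.disjoint_singleton.2 (hF.ne hab))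
    fun _ _ ↦ .of_discrete, Finset.sum_congr rfl h, Finset.sum_const, nsmul_eq_mul]

theorem drawLaw_exists_stateAt_eq_done {n : ℕ} (A : Finset ColorPointedTree)
    (hA : ∀ P ∈ A, P.tree.numNodes = n) :
    drawLaw {ω | ∃ P ∈ A, ∃ t, stateAt n ω t = .done P} =
      A.card * (weight n * tries n) := by
  have hstep := measurable_uncurry_step n
  let F (P : ColorPointedTree) : State := .returned (some (P, n))
  have hF : F.Injective := fun P P' h ↦ by simpa [F] using h
  have hevent : {ω | ∃ P ∈ A, ∃ t, stateAt n ω t = .done P} =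
      {ω | ∃ t, trajectory (step n) .start ω t ∈ ⋃ P ∈ A, {F P}} := by
    ext ω
    simp only [exists_stateAt_eq_done_iff, trajectory_step, Set.mem_ofPred_eq, Set.mem_iUnion,
      Set.mem_singleton_iff, F]
    grind
  rw [hevent, drawLaw, infinitePi_exists_trajectory_mem hstep .of_discrete, ← visits,
    visits_biUnion_singleton hF]
  · intro P hP
    rw [← visits_loop le_rfl P (hA P hP)]
    exact occupation_singleton_eq_of_eq_iff hstep
      (fun d σ ↦ step_eq_returned_some_iff.trans (and_iff_left le_rfl)) (by simp [F])
  · refine fun ω ↦ (subsingleton_setOf_stateAt_eq_returned n ω).anti fun t ht ↦ ?_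
    simp only [trajectory_step, Set.mem_ofPred_eq, Set.mem_iUnion, Set.mem_singleton_iff, F] at ht
    grind

theorem drawLaw_exists_stateAt_eq_done_eq_reach_mul_tries (n : ℕ) :
    drawLaw {ω | ∃ P ∈ colorPointedTreesOfSize n, ∃ t, stateAt n ω t = .done P} =
      reach n * tries n := by
  rw [drawLaw_exists_stateAt_eq_done _ fun P hP ↦ mem_colorPointedTreesOfSize.1 hP, reach,
    ENNReal.coe_mul, ENNReal.coe_natCast, mul_assoc]

theorem drawLaw_outputs {n : ℕ} {T : MTree} (hT : T.numNodes = n) :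
    drawLaw {ω | Outputs n ω T} = (n + 1 : ℕ) * (weight n * tries n) := by
  classical
  have hevent : {ω | Outputs n ω T} =
      {ω | ∃ P ∈ T.colorings.toFinset, ∃ t, stateAt n ω t = .done P} := by
    ext ω
    simp only [Outputs, List.mem_toFinset, mem_colorings, Set.mem_ofPred_eq]
    grind
  rw [hevent, drawLaw_exists_stateAt_eq_done,
    List.toFinset_card_of_nodup (nodup_colorings T), length_colorings, hT]
  intro P hP
  rw [mem_colorings.1 (List.mem_toFinset.1 hP), hT]

/-- The states in which a try starts, has to grow its tree further, or repoints. -/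
def State.Active (n : ℕ) : State → Prop
  | .start => True
  | .loop _ s => s < n
  | .seekLeft _ _ _ => True
  | .seekRight _ _ _ => True
  | .returned _ => False
  | .done _ => False

/-- The states in which a try leaves its loop. -/
def State.Leaving (n : ℕ) : State → Prop
  | .loop _ s => n ≤ s
  | _ => False

theorem active_seek {n : ℕ} (b : Bool) (g : Graft) (v : PointedTree) (s : ℕ) :
    (seek b g v s).Active n := by
  cases b <;> trivial

theorem visits_leaving_le (n : ℕ) :
    visits n {σ | σ.Leaving n} ≤ visits n {σ | σ.Active n} := by
  refine occupation_le_of_mem_of_apply_mem (measurable_uncurry_step n) .of_discrete .of_discrete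
    id fun d σ ↦ ?_
  apply step_cases (p := fun σ τ ↦ τ.Leaving n → σ.Active n) <;>
    grind [State.Leaving, State.Active, active_seek]

theorem visits_returned_le (n : ℕ) : visits n {σ | ∃ r, σ = .returned r} ≤
    visits n ({σ | σ.Active n} ∪ {σ | σ.Leaving n}) := by
  refine occupation_le_of_mem_of_apply_mem (measurable_uncurry_step n) .of_discrete .of_discrete
    (by simp) fun d σ ↦ ?_
  apply step_cases (p := fun σ τ ↦ (∃ r, τ = .returned r) → σ.Active n ∨ σ.Leaving n) <;>
    grind [State.Leaving, State.Active, active_seek]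

theorem visits_compl_done_le (n : ℕ) :
    visits n {σ | ∃ P, σ = .done P}ᶜ ≤ 4 * visits n {σ | σ.Active n} := by
  have hcover : {σ | ∃ P, σ = .done P}ᶜ ⊆
      {σ | σ.Active n} ∪ {σ | σ.Leaving n} ∪ {σ | ∃ r, σ = State.returned r} := by
    intro σ
    cases σ <;> simp [State.Active, State.Leaving, lt_or_ge]
  have hloop : visits n ({σ | σ.Active n} ∪ {σ | σ.Leaving n}) ≤ 2 * visits n {σ | σ.Active n} := by
    rw [two_mul]
    exact (measure_union_le _ _).trans (add_le_add_right (visits_leaving_le n) _)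
  calc visits n {σ | ∃ P, σ = .done P}ᶜ
      ≤ visits n ({σ | σ.Active n} ∪ {σ | σ.Leaving n}) + visits n {σ | ∃ r, σ = .returned r} :=
        (measure_mono hcover).trans (measure_union_le _ _)
    _ ≤ 2 * visits n {σ | σ.Active n} + 2 * visits n {σ | σ.Active n} :=
        add_le_add hloop ((visits_returned_le n).trans hloop)
    _ = 4 * visits n {σ | σ.Active n} := by ring

theorem card_pointedTreesOfSize_le (s : ℕ) :
    (pointedTreesOfSize s).card ≤ (colorPointedTreesOfSize s).card := by
  rw [card_pointedTreesOfSize, card_colorPointedTreesOfSize]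
  gcongr
  exact s.le_succ

theorem visits_iUnion_loop {n s : ℕ} (hs : s ≤ n) :
    visits n (⋃ P ∈ colorPointedTreesOfSize s, {.loop P s}) = reach s * tries n := by
  rw [visits_biUnion_singleton (fun P P' h ↦ by simpa using h)
    fun P hP ↦ visits_loop hs P (mem_colorPointedTreesOfSize.1 hP), reach,
    ENNReal.coe_mul, ENNReal.coe_natCast, mul_assoc]

theorem visits_iUnion_seek_le {n s : ℕ} (hs : s < n) (b : Bool) (g : Graft) :
    visits n (⋃ v ∈ pointedTreesOfSize s, {seek b g v s}) ≤ reach s * tries n := by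
  have hpow : (3⁻¹ : ℝ≥0∞) ^ g.added ≤ 1 := pow_le_one₀ zero_le (by simp)
  rw [visits_biUnion_singleton (fun v v' h ↦ by simpa [seek_inj] using h)
    fun ⟨c, t⟩ hv ↦ visits_seek hs (visits_loop hs.le) b g c t (mem_pointedTreesOfSize.1 hv), reach,
    ENNReal.coe_mul, ENNReal.coe_natCast, mul_assoc]
  refine mul_le_mul' ?_ (mul_le_of_le_one_left zero_le hpow)
  gcongr
  exact card_pointedTreesOfSize_le s

theorem visits_active_le (n : ℕ) : visits n {σ | σ.Active n} ≤
    (1 + 9 * ∑ s ∈ Finset.range n, (reach s : ℝ≥0∞)) * tries n := by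
  let atSize (s : ℕ) : Set State := (⋃ P ∈ colorPointedTreesOfSize s, {.loop P s}) ∪
    ⋃ x ∈ (Finset.univ : Finset (Bool × Graft)), ⋃ v ∈ pointedTreesOfSize s, {seek x.1 x.2 v s}
  have hcover : ∀ᵐ σ ∂visits n, σ.Active n → σ ∈ {.start} ∪ ⋃ s ∈ Finset.range n, atSize s := by
    filter_upwards [ae_visits_valid n] with σ hσ hactive
    induction σ using State.cases_seek with
    | start => exact .inl rfl
    | loop P s =>
      exact .inr (Set.mem_biUnion (Finset.mem_range.2 hactive)
        (.inl (Set.mem_biUnion (mem_colorPointedTreesOfSize.2 hσ.1) rfl)))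
    | seek b g v s =>
      obtain ⟨hv, hs⟩ := valid_seek_iff.1 hσ
      exact .inr (Set.mem_biUnion (Finset.mem_range.2 hs) (.inr (Set.mem_biUnion
        (Finset.mem_univ (b, g)) (Set.mem_biUnion (mem_pointedTreesOfSize.2 hv) rfl))))
    | returned r => exact hactive.elim
    | done P => exact hactive.elim
  have hatSize (s : ℕ) (hs : s ∈ Finset.range n) :
      visits n (atSize s) ≤ 9 * (reach s * tries n) := by
    rw [Finset.mem_range] at hs
    refine (measure_union_le _ _).trans ?_
    refine (add_le_add (visits_iUnion_loop hs.le).le ((measure_biUnion_finset_le _ _).trans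
      (Finset.sum_le_card_nsmul _ _ _ fun x _ ↦ visits_iUnion_seek_le hs x.1 x.2))).trans_eq ?_
    have hcard : (Finset.univ : Finset (Bool × Graft)).card = 8 := rfl
    rw [hcard, nsmul_eq_mul]
    push_cast
    ring
  calc visits n {σ | σ.Active n}
      ≤ visits n ({.start} ∪ ⋃ s ∈ Finset.range n, atSize s) := measure_mono_ae hcover
    _ ≤ tries n + ∑ s ∈ Finset.range n, visits n (atSize s) :=
        (measure_union_le _ _).trans (add_le_add_right (measure_biUnion_finset_le _ _) _)
    _ ≤ tries n + ∑ s ∈ Finset.range n, 9 * (reach s * tries n) := by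
        gcongr with s hs
        exact hatSize s hs
    _ = (1 + 9 * ∑ s ∈ Finset.range n, (reach s : ℝ≥0∞)) * tries n := by
        rw [← Finset.mul_sum, ← Finset.sum_mul]
        ring

instance : IsProbabilityMeasure drawLaw := by
  rw [drawLaw]
  infer_instance

theorem reach_mul_tries_le_one (n : ℕ) : reach n * tries n ≤ 1 := by
  rw [← drawLaw_exists_stateAt_eq_done_eq_reach_mul_tries]
  exact prob_le_one

theorem one_add_sum_reach_le {n : ℕ} (hn : 1 ≤ n) :
    1 + 9 * ∑ s ∈ Finset.range n, reach s ≤ 30 * n * reach n := by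
  obtain ⟨n, rfl⟩ := Nat.exists_eq_add_of_le' hn
  have hone : 1 ≤ ∑ s ∈ Finset.range (n + 2), reach s := by
    rw [← reach_one]
    exact Finset.single_le_sum (fun _ _ ↦ zero_le) (by simp)
  calc 1 + 9 * ∑ s ∈ Finset.range (n + 1), reach s
      ≤ ∑ s ∈ Finset.range (n + 2), reach s + 9 * ∑ s ∈ Finset.range (n + 2), reach s := by
        gcongr
        norm_num
    _ = 10 * ∑ s ∈ Finset.range (n + 2), reach s := by ring
    _ ≤ 10 * ((3 * n + 2) * reach (n + 1)) := by
        gcongr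
        exact sum_reach_le n
    _ ≤ 10 * ((3 * n + 3) * reach (n + 1)) := by
        gcongr
        norm_num
    _ = 30 * (n + 1 : ℕ) * reach (n + 1) := by
        push_cast
        ring

theorem visits_compl_done_le_mul {n : ℕ} (hn : 1 ≤ n) :
    visits n {σ | ∃ P, σ = .done P}ᶜ ≤ 120 * n := by
  have hsum : 1 + 9 * ∑ s ∈ Finset.range n, (reach s : ℝ≥0∞) ≤ 30 * n * reach n := by
    exact_mod_cast one_add_sum_reach_le hn
  calc visits n {σ | ∃ P, σ = .done P}ᶜ
      ≤ 4 * ((1 + 9 * ∑ s ∈ Finset.range n, (reach s : ℝ≥0∞)) * tries n) :=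
        (visits_compl_done_le n).trans (by gcongr; exact visits_active_le n)
    _ ≤ 4 * (30 * n * reach n * tries n) := by gcongr
    _ = 120 * n * (reach n * tries n) := by ring
    _ ≤ 120 * n := mul_le_of_le_one_right zero_le (reach_mul_tries_le_one n)

theorem runningTime_le_tsum (n : ℕ) (ω : Tape) : (runningTime n ω : ℝ≥0∞) ≤
    ∑' t, {σ | ∃ P, σ = State.done P}ᶜ.indicator 1 (stateAt n ω t) := by
  classical
  by_cases h : ∃ t P, stateAt n ω t = .done P
  · have hfind : runningTime n ω ≤ (Nat.find h : ℕ∞) := iInf₂_le (Nat.find h) (Nat.find_spec h)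
    calc (runningTime n ω : ℝ≥0∞) ≤ ((Nat.find h : ℕ∞) : ℝ≥0∞) := by exact_mod_cast hfind
      _ = ∑ t ∈ Finset.range (Nat.find h),
          {σ | ∃ P, σ = State.done P}ᶜ.indicator 1 (stateAt n ω t) := by
        rw [Finset.sum_congr rfl fun t ht ↦
          Set.indicator_of_mem (Nat.find_min h (Finset.mem_range.1 ht)) _]
        simp
      _ ≤ _ := ENNReal.sum_le_tsum _
  · push Not at h
    simp [h]

theorem lintegral_runningTime_le {n : ℕ} (hn : 1 ≤ n) :
    ∫⁻ ω, (runningTime n ω : ℝ≥0∞) ∂drawLaw ≤ 120 * n := by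
  calc ∫⁻ ω, (runningTime n ω : ℝ≥0∞) ∂drawLaw
      ≤ ∫⁻ ω, ∑' t, {σ | ∃ P, σ = State.done P}ᶜ.indicator 1
          (trajectory (step n) .start ω t) ∂drawLaw :=
        lintegral_mono fun ω ↦ by simpa only [trajectory_step] using runningTime_le_tsum n ω
    _ = visits n {σ | ∃ P, σ = .done P}ᶜ := by
        rw [drawLaw, lintegral_tsum_trajectory (measurable_uncurry_step n) .of_discrete,
          lintegral_indicator_one .of_discrete, visits]
    _ ≤ 120 * n := visits_compl_done_le_mul hn

theorem ae_outputs {n : ℕ} (hn : 1 ≤ n) :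
    ∀ᵐ ω ∂drawLaw, ∃ T : MTree, T.numNodes = n ∧ Outputs n ω T := by
  have hsum : ∑' t, drawLaw {ω | trajectory (step n) .start ω t ∈ {σ | ∃ P, σ = .done P}ᶜ} ≠ ∞ := by
    rw [drawLaw, ← occupation_apply (measurable_uncurry_step n) .of_discrete]
    exact ((visits_compl_done_le_mul hn).trans_lt (by finiteness)).ne
  filter_upwards [ae_eventually_notMem hsum] with ω hω
  obtain ⟨t, ht⟩ := hω.exists
  obtain ⟨P, hP⟩ : ∃ P, stateAt n ω t = .done P := by simpa [trajectory_step] using ht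
  have hvalid := valid_stateAt n ω t
  rw [hP] at hvalid
  exact ⟨P.tree, hvalid, t, P, hP, rfl⟩

theorem reach_mul_tries {n : ℕ} (hn : 1 ≤ n) : reach n * tries n = 1 := by
  rw [← drawLaw_exists_stateAt_eq_done_eq_reach_mul_tries, ← measure_univ (μ := drawLaw)]
  refine measure_congr (Filter.eventuallyEq_univ.2 ?_)
  filter_upwards [ae_outputs hn] with ω hω
  obtain ⟨T, hT, t, P, hP, rfl⟩ := hω
  exact ⟨P, mem_colorPointedTreesOfSize.2 hT, t, hP⟩

theorem drawLaw_outputs_eq_inv {n : ℕ} (hn : 1 ≤ n) {T : MTree} (hT : T.numNodes = n) :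
    drawLaw {ω | Outputs n ω T} =
      ((Nat.card {T' : MTree // T'.numNodes = n} : ℕ) : ℝ≥0∞)⁻¹ := by
  rw [drawLaw_outputs hT, natCard_numNodes_eq]
  refine ENNReal.eq_inv_of_mul_eq_one_left ?_
  rw [← reach_mul_tries hn, reach, card_colorPointedTreesOfSize]
  push_cast
  ring

end MotzkinSampler

theorem mainTheorem3 :
    (∀ n : ℕ, 1 ≤ n →
      (∀ᵐ ω ∂MotzkinSampler.drawLaw,
        ∃ T : MotzkinSampler.MTree, T.numNodes = n ∧ MotzkinSampler.Outputs n ω T) ∧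
      ∀ T : MotzkinSampler.MTree, T.numNodes = n →
        MotzkinSampler.drawLaw {ω | MotzkinSampler.Outputs n ω T} =
          ((Nat.card {T' : MotzkinSampler.MTree // T'.numNodes = n} : ℕ) : ℝ≥0∞)⁻¹) ∧
    ∃ C : ℝ≥0, ∀ n : ℕ, 1 ≤ n →
      ∫⁻ ω, (MotzkinSampler.runningTime n ω : ℝ≥0∞) ∂MotzkinSampler.drawLaw
        ≤ (C : ℝ≥0∞) * (n : ℝ≥0∞) :=
  ⟨fun _ hn ↦ ⟨MotzkinSampler.ae_outputs hn, fun _ ↦ MotzkinSampler.drawLaw_outputs_eq_inv hn⟩,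
    120, fun _ hn ↦ by simpa using MotzkinSampler.lintegral_runningTime_le hn⟩
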